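/- Let $\mathbb{D}=\{z\in\mathbb{C}:|z|<1\}$ and $\varphi(z)=(1+z/2)^2$. Let $\mathcal{C}(\varphi)$ be the class of analytic functions $f$ on $\mathbb{D}$ with $f(0)=0$, $f'(0)=1$, $f'(z)\neq 0$ for $z\in\mathbb{D}$, such that $1+zf''(z)/f'(z)\prec\varphi(z)$, i.e. there is an analytic function $\omega:\mathbb{D}\to\mathbb{D}$ with $\omega(0)=0$ and $1+zf''(z)/f'(z)=\varphi(\omega(z))$ for all $z\in\mathbb{D}$. For $f(z)=z+\sum_{n\ge 2}a_nz^n$ put $$H_3(1)=\begin{vmatrix}1&a_2&a_3\\a_2&a_3&a_4\\a_3&a_4&a_5\end{vmatrix}.$$ Then $|H_3(1)|\le 1/144$ for every $f\in\mathcal{C}(\varphi)$. The bound is sharp: there is a function $f\in\mathcal{C}(\varphi)$ with $1+zf''(z)/f'(z)=\varphi(z^3)$ (that is, $\omega(z)=z^3$) and $f'(z)=\exp(z^3/3+z^6/24)$ on $\mathbb{D}$, and it satisfies $|H_3(1)|=1/144$. -/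

import Mathlib

open Metric

noncomputable section

/-- The class `𝒜`: functions analytic in the open unit disk with `f 0 = 0` and `f' 0 = 1`. Values of
`f : ℂ → ℂ` outside the disk play no role. -/
def classA : Set (ℂ → ℂ) :=
  {f | AnalyticOnNhd ℂ f (ball 0 1) ∧ f 0 = 0 ∧ deriv f 0 = 1}

/-- Schwarz functions: analytic self-maps of the open unit disk fixing `0`. -/
def IsSchwarz (ω : ℂ → ℂ) : Prop :=
  AnalyticOnNhd ℂ ω (ball 0 1) ∧ ω 0 = 0 ∧ ∀ z ∈ ball (0 : ℂ) 1, ‖ω z‖ < 1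

/-- Subordination `g ≺ h` in the open unit disk. -/
def Subordinate (g h : ℂ → ℂ) : Prop :=
  ∃ ω : ℂ → ℂ, IsSchwarz ω ∧ ∀ z ∈ ball (0 : ℂ) 1, g z = h (ω z)

/-- The Ma–Minda convex class `𝒞(φ)`: all `f ∈ 𝒜` with `1 + z f''(z) / f'(z) ≺ φ(z)`. That `f'` has
no zero in the disk is what makes the quotient an analytic function there. -/
def convexClass (φ : ℂ → ℂ) : Set (ℂ → ℂ) :=
  {f | f ∈ classA ∧ (∀ z ∈ ball (0 : ℂ) 1, deriv f z ≠ 0) ∧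
    Subordinate (fun z => 1 + z * deriv (deriv f) z / deriv f z) φ}

/-- The function `φ(z) = (1 + z/2)²`. -/
def phi (z : ℂ) : ℂ := (1 + z / 2) ^ 2

/-- The `n`-th Taylor coefficient `a_n` of `f` at `0`. -/
def taylorCoeff (f : ℂ → ℂ) (n : ℕ) : ℂ := iteratedDeriv n f 0 / (n.factorial : ℂ)

/-- The Hankel determinant `H_q(n)`, the determinant of the `q × q` matrix with entries
`a_{n+i+j}`, `0 ≤ i, j < q`. -/
def hankelDet (f : ℂ → ℂ) (q n : ℕ) : ℂ :=
  Matrix.det (Matrix.of fun i j : Fin q => taylorCoeff f (n + i + j))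

end

/-! Since `phi w - 1 = w + w ^ 2 / 4`, subordination says `z f'' = f' (ω + ω ^ 2 / 4)`. Comparing
coefficients expresses `a₂, …, a₅`, and hence the determinant (`hankelDet_three_one_eq`), as a
polynomial in the coefficients `c₁, …, c₄` of `ω`. As `|ω| ≤ 1`, Parseval gives `∑ |cₙ|² ≤ 1`
(`sum_sq_norm_taylorCoeff_le_one`). This alone suffices: the only large term is `-c₃ ^ 2 / 144`, and
the triangle inequality loses nothing that matters. For `ω = z ^ 3` only that term survives, whence
sharpness. -/

/-- Each monomial is dominated by a combination of the squares `‖cᵢ‖ ^ 2`; no square collects a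
total weight above `1 / 144`. -/
theorem norm_sum_le_of_bessel {c₁ c₂ c₃ c₄ : ℂ}
    (h : ‖c₁‖ ^ 2 + ‖c₂‖ ^ 2 + ‖c₃‖ ^ 2 + ‖c₄‖ ^ 2 ≤ 1) :
    ‖-c₃ ^ 2 / 144 + c₂ * c₄ / 120 + 7 * c₂ ^ 3 / 4320 + c₁ * c₂ * c₃ / 720 - c₁ ^ 2 * c₄ / 480
      - 17 * c₁ ^ 2 * c₂ ^ 2 / 5760 + c₁ ^ 3 * c₃ / 720 + 7 * c₁ ^ 4 * c₂ / 11520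
      - 7 * c₁ ^ 6 / 69120‖ ≤ 1 / 144 := by
  have key : ‖-c₃ ^ 2 / 144 + c₂ * c₄ / 120 + 7 * c₂ ^ 3 / 4320 + c₁ * c₂ * c₃ / 720
      - c₁ ^ 2 * c₄ / 480 - 17 * c₁ ^ 2 * c₂ ^ 2 / 5760 + c₁ ^ 3 * c₃ / 720
      + 7 * c₁ ^ 4 * c₂ / 11520 - 7 * c₁ ^ 6 / 69120‖ ≤
      ‖c₃‖ ^ 2 / 144 + ‖c₂‖ * ‖c₄‖ / 120 + 7 * ‖c₂‖ ^ 3 / 4320 + ‖c₁‖ * ‖c₂‖ * ‖c₃‖ / 720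
      + ‖c₁‖ ^ 2 * ‖c₄‖ / 480 + 17 * ‖c₁‖ ^ 2 * ‖c₂‖ ^ 2 / 5760 + ‖c₁‖ ^ 3 * ‖c₃‖ / 720
      + 7 * ‖c₁‖ ^ 4 * ‖c₂‖ / 11520 + 7 * ‖c₁‖ ^ 6 / 69120 := by
    refine (norm_sub_le _ _).trans (add_le_add ?_ (by simp))
    refine (norm_add_le _ _).trans (add_le_add ?_ (by simp))
    refine (norm_add_le _ _).trans (add_le_add ?_ (by simp))
    refine (norm_sub_le _ _).trans (add_le_add ?_ (by simp))
    refine (norm_sub_le _ _).trans (add_le_add ?_ (by simp))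
    refine (norm_add_le _ _).trans (add_le_add ?_ (by simp))
    refine (norm_add_le _ _).trans (add_le_add ?_ (by simp))
    exact (norm_add_le _ _).trans (add_le_add (by simp) (by simp))
  refine key.trans ?_
  have h₁ := norm_nonneg c₁
  have h₂ := norm_nonneg c₂
  have h₃ := norm_nonneg c₃
  have h₄ := norm_nonneg c₄
  generalize ‖c₁‖ = p at *
  generalize ‖c₂‖ = q at *
  generalize ‖c₃‖ = r at *
  generalize ‖c₄‖ = s at *
  have hp : p ≤ 1 := by nlinarith
  have hq : q ≤ 1 := by nlinarith
  have hr : r ≤ 1 := by nlinarith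
  have e₁ : q * s ≤ (q ^ 2 + s ^ 2) / 2 := by nlinarith [sq_nonneg (q - s)]
  have e₂ : q ^ 3 ≤ q ^ 2 := pow_le_pow_of_le_one h₂ hq (by norm_num)
  have e₃ : p * q * r ≤ (p ^ 2 + q ^ 2) / 2 :=
    (mul_le_of_le_one_right (by positivity) hr).trans (by nlinarith [sq_nonneg (p - q)])
  have e₄ : p ^ 2 * s ≤ (p ^ 2 + s ^ 2) / 2 := by
    nlinarith [sq_nonneg (p - s), mul_le_mul_of_nonneg_right hp (mul_nonneg h₁ h₄)]
  have e₅ : p ^ 2 * q ^ 2 ≤ p ^ 2 := mul_le_of_le_one_right (by positivity) (pow_le_one₀ h₂ hq)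
  have e₆ : p ^ 3 * r ≤ p ^ 2 / 2 := by
    have : p * r ≤ 1 / 2 := by nlinarith [sq_nonneg (p - r), sq_nonneg q, sq_nonneg s]
    nlinarith [mul_le_mul_of_nonneg_left this (sq_nonneg p)]
  have e₇ : p ^ 4 * q ≤ p ^ 2 :=
    (mul_le_of_le_one_right (by positivity) hq).trans (pow_le_pow_of_le_one h₁ hp (by norm_num))
  have e₈ : p ^ 6 ≤ p ^ 2 := pow_le_pow_of_le_one h₁ hp (by norm_num)
  -- The total weights are `421/69120` on `p ^ 2`, `28/4320` on `q ^ 2`, `1/144` on `r ^ 2` and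
  -- `1/192` on `s ^ 2`.
  nlinarith [sq_nonneg p, sq_nonneg q, sq_nonneg s]

/-- Cauchy's formula for the `n`-th derivative, parametrized by `z = r e^{iθ}`. -/
theorem fourierCoeffOn_circleMap {ω : ℂ → ℂ} (hω : DifferentiableOn ℂ ω (ball 0 1)) {r : ℝ}
    (h₀ : 0 < r) (h₁ : r < 1) (n : ℕ) :
    fourierCoeffOn Real.two_pi_pos (fun θ => ω (circleMap 0 r θ)) n =
      (r : ℂ) ^ n * taylorCoeff ω n := by
  have hd : DiffContOnCl ℂ ω (ball 0 r) :=
    (hω.mono (closedBall_subset_ball h₁)).diffContOnCl_ball subset_rfl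
  have hr : (r : ℂ) ≠ 0 := by exact_mod_cast h₀.ne'
  have hc := hd.circleIntegral_one_div_sub_center_pow_smul h₀ n
  rw [circleIntegral] at hc
  have hT : taylorCoeff ω n = (2 * Real.pi * Complex.I)⁻¹ *
      ((2 * Real.pi * Complex.I / n.factorial) • iteratedDeriv n ω 0) := by
    have := Complex.two_pi_I_ne_zero
    rw [taylorCoeff, smul_eq_mul]
    field_simp
  rw [hT, ← hc, fourierCoeffOn_eq_integral, ← mul_assoc, ← intervalIntegral.integral_const_mul,
    ← intervalIntegral.integral_smul]
  congr 1
  ext θ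
  rw [fourier_coe_apply]
  have he : Complex.exp (2 * Real.pi * Complex.I * ((-(n : ℤ) : ℤ) : ℂ) * θ /
      ((2 * Real.pi - 0 : ℝ) : ℂ)) = (Complex.exp (θ * Complex.I) ^ n)⁻¹ := by
    rw [← Complex.exp_nat_mul, ← Complex.exp_neg]
    congr 1
    have := Complex.ofReal_ne_zero.2 Real.pi_ne_zero
    push_cast
    field_simp
    ring
  rw [he]
  have hπ := Complex.ofReal_ne_zero.2 Real.pi_ne_zero
  have hE := Complex.exp_ne_zero (θ * Complex.I)
  simp only [deriv_circleMap, circleMap, zero_add, sub_zero, smul_eq_mul, Complex.real_smul]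
  push_cast
  have := Complex.I_ne_zero
  field_simp
  ring

/-- Parseval on the circle of radius `r < 1`, where the mean of `|ω|²` is at most `1`; then `r → 1`.
-/
theorem sum_sq_norm_taylorCoeff_le_one {ω : ℂ → ℂ} (hω : DifferentiableOn ℂ ω (ball 0 1))
    (hb : ∀ z ∈ ball (0 : ℂ) 1, ‖ω z‖ ≤ 1) (s : Finset ℕ) :
    ∑ n ∈ s, ‖taylorCoeff ω n‖ ^ 2 ≤ 1 := by
  have hr : ∀ r ∈ Set.Ioo (0 : ℝ) 1, ∑ n ∈ s, (r ^ n * ‖taylorCoeff ω n‖) ^ 2 ≤ 1 := by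
    rintro r ⟨h₀, h₁⟩
    have hmem (θ : ℝ) : circleMap 0 r θ ∈ ball (0 : ℂ) 1 := by
      simpa [abs_of_pos h₀] using h₁
    have hcont : Continuous fun θ => ω (circleMap 0 r θ) :=
      hω.continuousOn.comp_continuous (continuous_circleMap 0 r) hmem
    have hsum := hasSum_sq_fourierCoeffOn (f := fun θ => ω (circleMap 0 r θ)) Real.two_pi_pos
      (MeasureTheory.MemLp.of_bound hcont.aestronglyMeasurable 1
        (Filter.Eventually.of_forall fun θ => hb _ (hmem θ)))
    have hle := sum_le_hasSum (s.map Nat.castEmbedding) (fun _ _ => by positivity) hsum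
    rw [Finset.sum_map] at hle
    simp only [Nat.castEmbedding_apply, fourierCoeffOn_circleMap hω h₀ h₁, norm_mul, norm_pow,
      Complex.norm_real, Real.norm_of_nonneg h₀.le] at hle
    refine hle.trans ?_
    have hint : ∫ θ in (0 : ℝ)..(2 * Real.pi), ‖ω (circleMap 0 r θ)‖ ^ 2 ≤
        ∫ _ in (0 : ℝ)..(2 * Real.pi), (1 : ℝ) :=
      intervalIntegral.integral_mono Real.two_pi_pos.le
        ((hcont.norm.pow 2).intervalIntegrable _ _) (by simp)
        fun θ => pow_le_one₀ (norm_nonneg _) (hb _ (hmem θ))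
    rw [intervalIntegral.integral_const, smul_eq_mul, mul_one] at hint
    rw [smul_eq_mul, inv_mul_le_iff₀ (by simpa using Real.pi_pos), mul_one]
    exact hint
  have hlim : Filter.Tendsto (fun r : ℝ => ∑ n ∈ s, (r ^ n * ‖taylorCoeff ω n‖) ^ 2)
      (nhdsWithin 1 (Set.Iio 1)) (nhds (∑ n ∈ s, ‖taylorCoeff ω n‖ ^ 2)) := by
    have : Continuous fun r : ℝ => ∑ n ∈ s, (r ^ n * ‖taylorCoeff ω n‖) ^ 2 := by fun_prop
    simpa using (this.tendsto 1).mono_left nhdsWithin_le_nhds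
  exact le_of_tendsto hlim
    (Filter.eventually_of_mem (Ioo_mem_nhdsLT zero_lt_one) hr)

theorem taylorCoeff_mul {f g : ℂ → ℂ} (hf : AnalyticAt ℂ f 0) (hg : AnalyticAt ℂ g 0) (n : ℕ) :
    taylorCoeff (fun z => f z * g z) n =
      ∑ i ∈ Finset.range (n + 1), taylorCoeff f i * taylorCoeff g (n - i) := by
  rw [taylorCoeff, iteratedDeriv_fun_mul hf.contDiffAt hg.contDiffAt, Finset.sum_div]
  refine Finset.sum_congr rfl fun i hi => ?_
  have h := Nat.choose_mul_factorial_mul_factorial (Nat.lt_succ_iff.1 (Finset.mem_range.1 hi))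
  have h₀ := Nat.cast_ne_zero (R := ℂ).2 n.factorial_ne_zero
  have h₁ := Nat.cast_ne_zero (R := ℂ).2 i.factorial_ne_zero
  have h₂ := Nat.cast_ne_zero (R := ℂ).2 (n - i).factorial_ne_zero
  rw [taylorCoeff, taylorCoeff]
  field_simp
  rw [← h]
  push_cast
  ring

theorem taylorCoeff_add {f g : ℂ → ℂ} (hf : AnalyticAt ℂ f 0) (hg : AnalyticAt ℂ g 0) (n : ℕ) :
    taylorCoeff (fun z => f z + g z) n = taylorCoeff f n + taylorCoeff g n := by
  rw [taylorCoeff, iteratedDeriv_fun_add hf.contDiffAt hg.contDiffAt, add_div]; rfl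

theorem taylorCoeff_const_mul (c : ℂ) (f : ℂ → ℂ) (n : ℕ) :
    taylorCoeff (fun z => c * f z) n = c * taylorCoeff f n := by
  rw [taylorCoeff, iteratedDeriv_const_mul_field, mul_div_assoc]; rfl

theorem taylorCoeff_pow (m n : ℕ) :
    taylorCoeff (fun z => z ^ m) n = if n = m then 1 else 0 := by
  rw [taylorCoeff, iteratedDeriv_fun_pow_zero]
  split_ifs with h
  · rw [h, div_self (Nat.cast_ne_zero.2 m.factorial_ne_zero)]
  · simp

theorem taylorCoeff_deriv (f : ℂ → ℂ) (n : ℕ) :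
    taylorCoeff (deriv f) n = (n + 1) * taylorCoeff f (n + 1) := by
  rw [taylorCoeff, taylorCoeff, ← iteratedDeriv_succ', Nat.factorial_succ]
  push_cast
  have := Nat.cast_add_one_ne_zero (R := ℂ) n
  field_simp

theorem taylorCoeff_congr {f g : ℂ → ℂ} (h : f =ᶠ[nhds 0] g) (n : ℕ) :
    taylorCoeff f n = taylorCoeff g n := by
  rw [taylorCoeff, taylorCoeff, h.iteratedDeriv_eq]

theorem hankelDet_three_one_eq {f ω : ℂ → ℂ} (hf : f ∈ classA) (hω : AnalyticAt ℂ ω 0)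
    (hω₀ : ω 0 = 0)
    (h : ∀ᶠ z in nhds (0 : ℂ), z * deriv (deriv f) z = deriv f z * (ω z + 1 / 4 * (ω z * ω z))) :
    hankelDet f 3 1 =
      -taylorCoeff ω 3 ^ 2 / 144 + taylorCoeff ω 2 * taylorCoeff ω 4 / 120
      + 7 * taylorCoeff ω 2 ^ 3 / 4320 + taylorCoeff ω 1 * taylorCoeff ω 2 * taylorCoeff ω 3 / 720
      - taylorCoeff ω 1 ^ 2 * taylorCoeff ω 4 / 480
      - 17 * taylorCoeff ω 1 ^ 2 * taylorCoeff ω 2 ^ 2 / 5760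
      + taylorCoeff ω 1 ^ 3 * taylorCoeff ω 3 / 720
      + 7 * taylorCoeff ω 1 ^ 4 * taylorCoeff ω 2 / 11520 - 7 * taylorCoeff ω 1 ^ 6 / 69120 := by
  obtain ⟨hfa, -, hf₁⟩ := hf
  have ha : AnalyticAt ℂ f 0 := hfa 0 (mem_ball_self one_pos)
  have hsq : AnalyticAt ℂ (fun z => 1 / 4 * (ω z * ω z)) 0 := analyticAt_const.mul (hω.mul hω)
  -- Writing `z` as `z ^ 1` lets `taylorCoeff_pow` apply.
  have hcoeff (n : ℕ) : taylorCoeff (fun z => z ^ 1 * deriv (deriv f) z) n =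
      taylorCoeff (fun z => deriv f z * (ω z + 1 / 4 * (ω z * ω z))) n :=
    taylorCoeff_congr (by simp only [pow_one]; exact h) n
  simp only [taylorCoeff_mul (f := fun z => z ^ 1) (analyticAt_id.fun_pow 1) ha.deriv.deriv,
    taylorCoeff_mul ha.deriv (hω.fun_add hsq), taylorCoeff_add hω hsq, taylorCoeff_const_mul,
    taylorCoeff_mul hω hω, taylorCoeff_pow, taylorCoeff_deriv] at hcoeff
  have w₀ : taylorCoeff ω 0 = 0 := by simp [taylorCoeff, hω₀]
  have a₁ : taylorCoeff f 1 = 1 := by simp [taylorCoeff, hf₁]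
  have h₁ := hcoeff 1
  have h₂ := hcoeff 2
  have h₃ := hcoeff 3
  have h₄ := hcoeff 4
  norm_num [Finset.sum_range_succ, w₀, a₁] at h₁ h₂ h₃ h₄
  simp only [hankelDet, Matrix.det_fin_three, Matrix.of_apply]
  norm_num [a₁]
  generalize taylorCoeff ω 1 = c₁, taylorCoeff ω 2 = c₂, taylorCoeff ω 3 = c₃,
    taylorCoeff ω 4 = c₄ at *
  rw [mul_comm, ← eq_div_iff (by norm_num)] at h₁
  rw [← mul_assoc, mul_comm, ← eq_div_iff (by norm_num)] at h₂ h₃ h₄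
  -- Each `hₙ` gives `aₙ₊₁` in terms of lower coefficients, so elimination starts from `a₅`.
  rw [h₄, h₃, h₂, h₁]
  ring

theorem exists_mem_convexClass_extremal : ∃ f ∈ convexClass phi,
    (∀ z ∈ ball (0 : ℂ) 1, 1 + z * deriv (deriv f) z / deriv f z = phi (z ^ 3)) ∧
    ∀ z ∈ ball (0 : ℂ) 1, deriv f z = Complex.exp (z ^ 3 / 3 + z ^ 6 / 24) := by
  have hd : Differentiable ℂ fun z : ℂ => Complex.exp (z ^ 3 / 3 + z ^ 6 / 24) := by fun_prop
  -- The extremal function is the primitive of this entire function that vanishes at `0`.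
  obtain ⟨f, hf₀, hf⟩ := hd.isExactOn_univ.with_val_at 0 0
  have hf' : deriv f = fun z => Complex.exp (z ^ 3 / 3 + z ^ 6 / 24) :=
    funext fun z => (hf z trivial).deriv
  have hf'' (z : ℂ) : deriv (deriv f) z = deriv f z * (z ^ 2 + z ^ 5 / 4) := by
    have h₁ : HasDerivAt (fun z : ℂ => z ^ 3 / 3 + z ^ 6 / 24) (z ^ 2 + z ^ 5 / 4) z := by
      refine (((hasDerivAt_pow 3 z).div_const 3).fun_add
        ((hasDerivAt_pow 6 z).div_const 24)).congr_deriv ?_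
      norm_num
      ring
    rw [hf']
    exact h₁.cexp.deriv
  have hne (z : ℂ) : deriv f z ≠ 0 := by rw [hf']; exact Complex.exp_ne_zero _
  have hphi (z : ℂ) : 1 + z * deriv (deriv f) z / deriv f z = phi (z ^ 3) := by
    have := hne z
    rw [hf'', phi]
    field_simp
    ring
  have hfd : Differentiable ℂ f := fun z => (hf z trivial).differentiableAt
  have hcube : IsSchwarz fun z => z ^ 3 :=
    ⟨fun z _ => analyticAt_id.pow 3, by simp, fun z hz => by
      rw [norm_pow]
      exact pow_lt_one₀ (norm_nonneg z) (by simpa using hz) (by norm_num)⟩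
  exact ⟨f, ⟨⟨fun z _ => hfd.analyticAt z, hf₀, by simp [hf']⟩, fun z _ => hne z,
    fun z => z ^ 3, hcube, fun z _ => hphi z⟩, fun z _ => hphi z, fun z _ => congrFun hf' z⟩

theorem eventually_mul_deriv_deriv_eq {f ω : ℂ → ℂ}
    (hne : ∀ z ∈ ball (0 : ℂ) 1, deriv f z ≠ 0)
    (h : ∀ z ∈ ball (0 : ℂ) 1, 1 + z * deriv (deriv f) z / deriv f z = phi (ω z)) :
    ∀ᶠ z in nhds (0 : ℂ), z * deriv (deriv f) z = deriv f z * (ω z + 1 / 4 * (ω z * ω z)) := by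
  filter_upwards [ball_mem_nhds (0 : ℂ) one_pos] with z hz
  have h₁ := hne z hz
  have h₂ : z * deriv (deriv f) z / deriv f z = ω z + 1 / 4 * (ω z * ω z) := by
    have := h z hz
    rw [phi] at this
    linear_combination this
  rw [← h₂, mul_div_cancel₀ _ h₁]

theorem theorem3p2 :
    (∀ f ∈ convexClass phi, ‖hankelDet f 3 1‖ ≤ 1 / 144) ∧
    ∃ f ∈ convexClass phi,
      (∀ z ∈ ball (0 : ℂ) 1, 1 + z * deriv (deriv f) z / deriv f z = phi (z ^ 3)) ∧
      (∀ z ∈ ball (0 : ℂ) 1, deriv f z = Complex.exp (z ^ 3 / 3 + z ^ 6 / 24)) ∧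
      ‖hankelDet f 3 1‖ = 1 / 144 := by
  constructor
  · rintro f ⟨hf, hne, ω, ⟨hω, hω₀, hlt⟩, h⟩
    rw [hankelDet_three_one_eq hf (hω 0 (mem_ball_self one_pos)) hω₀
      (eventually_mul_deriv_deriv_eq hne h)]
    refine norm_sum_le_of_bessel ?_
    have hb := sum_sq_norm_taylorCoeff_le_one hω.differentiableOn (fun z hz => (hlt z hz).le)
      (Finset.Icc 1 4)
    simpa [Finset.sum_Icc_succ_top] using hb
  · obtain ⟨f, hf, h, h'⟩ := exists_mem_convexClass_extremal
    refine ⟨f, hf, h, h', ?_⟩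
    rw [hankelDet_three_one_eq (ω := fun z => z ^ 3) hf.1 (analyticAt_id.pow 3) (by simp)
      (eventually_mul_deriv_deriv_eq hf.2.1 h)]
    norm_num [taylorCoeff_pow]
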